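/- Let $M$ be a smooth manifold of dimension $m$ (Hausdorff, second countable, without boundary) and let $\{U_i\}_{i\in I}$ be an open cover of $M$. Consider the conditions: (F1) on every $U_i$ there is given a regular foliation $\mathcal F_i$ of dimension $r_i$, that is, a partition of $U_i$ into connected $r_i$-dimensional immersed submanifolds (the leaves) such that around each point of $U_i$ there is a smooth chart of $M$, with domain contained in $U_i$ and with image an open cube, in which every leaf is a union of countably many (possibly no) slices on which the last $m-r_i$ coordinates are constant; (F2) if $i\neq j$, then $r_i\neq r_j$; (F3) if $U_i\cap U_j\neq\emptyset$ and $r_i<r_j$, then $U_i\cap U_j$ is a union of open subsets of leaves of $\mathcal F_j$, and every open subset of a leaf of $\mathcal F_j$ that is contained in $U_i\cap U_j$ is a union of open subsets of leaves of $\mathcal F_i$ (open in the manifold topology of the leaf); (F3$'$) if $U_i\cap U_j\neq\emptyset$ and $r_i<r_j$, then $U_i\cap U_j$ is a union of leaves of $\mathcal F_j$, and every leaf of $\mathcal F_j$ contained in $U_i\cap U_j$ is a union of leaves of $\mathcal F_i$. For $x\in M$ put $r(x)=\max\{r_i : x\in U_i\}$ and let $\mathcal D_x\subset T_xM$ be the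 tangent space at $x$ of the leaf through $x$ of $\mathcal F_i$, where $i$ is the index with $x\in U_i$ and $r_i=r(x)$. The singular distribution $\mathcal D=(\mathcal D_x)_{x\in M}$ is called *smooth* if every $\mathcal D_x$ is spanned by the values at $x$ of smooth vector fields that are defined on open neighbourhoods of $x$ and are tangent to $\mathcal D$ at every point of their domain. It is called *integrable* if it is smooth and there is a partition of $M$ into connected immersed submanifolds (of possibly different dimensions) such that $\mathcal D_x=T_xL$ for every member $L$ of the partition and every $x\in L$; the partition is then a Stefan–Sussmann singular foliation. 1. If (F1), (F2) and (F3) hold, then $\mathcal D$ is a smooth singular distribution on $M$. 2. If (F1), (F2) and (F3$'$) hold, then $\mathcal D$ is integrable. -/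

import Mathlib

open scoped Manifold ContDiff

universe u

/-- An (injectively) immersed submanifold of the smooth `m`-manifold `M`, without boundary: a
second countable Hausdorff smooth manifold `N` of dimension `dim` with an injective smooth
immersion `ι : N → M`. The subset of `M` is the range of `ι`; the topology and the smooth
structure of `N` may be finer than those induced from `M`. -/
structure ImmersedSubmanifold (m : ℕ) (M : Type u) [TopologicalSpace M]
    [ChartedSpace (EuclideanSpace ℝ (Fin m)) M] where
  dim : ℕ
  N : Type u
  [top : TopologicalSpace N]
  [charted : ChartedSpace (EuclideanSpace ℝ (Fin dim)) N]
  [isManifold : IsManifold (𝓡 dim) ∞ N]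
  [t2 : T2Space N]
  [secondCountable : SecondCountableTopology N]
  ι : N → M
  injective : Function.Injective ι
  isImmersion : Manifold.IsImmersion (𝓡 dim) (𝓡 m) ∞ ι

attribute [instance] ImmersedSubmanifold.top ImmersedSubmanifold.charted
  ImmersedSubmanifold.isManifold ImmersedSubmanifold.t2 ImmersedSubmanifold.secondCountable

section Manifolds

variable {m : ℕ} {M : Type u} [TopologicalSpace M] [ChartedSpace (EuclideanSpace ℝ (Fin m)) M]

/-- The underlying subset of `M`. -/
def ImmersedSubmanifold.carrier (L : ImmersedSubmanifold m M) : Set M := Set.range L.ι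

/-- `T_x L ⊆ T_x M`, the image of the differential of the immersion at the (unique) point over
`x`; it is `⊥` if `x` is not in `L`. -/
noncomputable def ImmersedSubmanifold.tangentSpace (L : ImmersedSubmanifold m M) (x : M) :
    Submodule ℝ (TangentSpace (𝓡 m) x) :=
  ⨆ (y : L.N) (h : L.ι y = x),
    h ▸ LinearMap.range (mfderiv (𝓡 L.dim) (𝓡 m) L.ι y).toLinearMap

theorem ImmersedSubmanifold.tangentSpace_apply (L : ImmersedSubmanifold m M) (y : L.N) :
    L.tangentSpace (L.ι y) = LinearMap.range (mfderiv (𝓡 L.dim) (𝓡 m) L.ι y).toLinearMap := by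
  refine le_antisymm (iSup₂_le fun z h => ?_) ?_
  · obtain rfl := L.injective h
    exact le_rfl
  · exact le_iSup₂_of_le y rfl le_rfl

/-- `𝓛` is a partition of `U` into connected immersed submanifolds (each connected, hence
nonempty, in its own manifold topology). -/
structure IsPartitionIntoConnected (𝓛 : Set (ImmersedSubmanifold m M)) (U : Set M) : Prop where
  connected : ∀ L ∈ 𝓛, ConnectedSpace L.N
  pairwiseDisjoint : 𝓛.PairwiseDisjoint ImmersedSubmanifold.carrier
  iUnion_eq : ⋃ L ∈ 𝓛, L.carrier = U

/-- `φ` is a flat chart, for `p`-dimensional leaves, of a collection `𝓛` of subsets of `M`: a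
smooth chart of `M` onto an open cube in which each member of `𝓛` is the union of countably many
(possibly no) slices `{z | z_a = c_a for all a ≥ p}` (indices from `0`). -/
structure IsFlatChart (𝓛 : Set (Set M)) (p : ℕ)
    (φ : OpenPartialHomeomorph M (EuclideanSpace ℝ (Fin m))) : Prop where
  mem_maximalAtlas : φ ∈ IsManifold.maximalAtlas (𝓡 m) ∞ M
  target_eq : ∃ lo hi : Fin m → ℝ, φ.target = {z | ∀ a, z a ∈ Set.Ioo (lo a) (hi a)}
  slices : ∀ L ∈ 𝓛, ∃ C : Set ({a : Fin m // p ≤ (a : ℕ)} → ℝ), C.Countable ∧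
    ∀ x ∈ φ.source, x ∈ L ↔ (fun a : {a : Fin m // p ≤ (a : ℕ)} => φ x a) ∈ C

/-- A regular foliation of dimension `p` on the subset `U` of `M` (used for open `U`): a partition
of `U` into connected `p`-dimensional immersed submanifolds, the leaves, with a flat chart inside
`U` around each point of `U`. -/
structure RegularFoliation (m : ℕ) (M : Type u) [TopologicalSpace M]
    [ChartedSpace (EuclideanSpace ℝ (Fin m)) M] (U : Set M) (p : ℕ) where
  leaves : Set (ImmersedSubmanifold m M)
  dim_eq : ∀ L ∈ leaves, L.dim = p
  isPartition : IsPartitionIntoConnected leaves U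
  exists_flatChart : ∀ x ∈ U, ∃ φ : OpenPartialHomeomorph M (EuclideanSpace ℝ (Fin m)),
    x ∈ φ.source ∧ φ.source ⊆ U ∧ IsFlatChart (ImmersedSubmanifold.carrier '' leaves) p φ

namespace RegularFoliation

variable {U : Set M} {p : ℕ}

/-- The leaves, as subsets of `M`. -/
def leafSets (F : RegularFoliation m M U p) : Set (Set M) :=
  ImmersedSubmanifold.carrier '' F.leaves

/-- The subsets of `M` that are open subsets of some leaf, for the manifold topology of that
leaf. -/
def openSubsetsOfLeaves (F : RegularFoliation m M U p) : Set (Set M) :=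
  {A | ∃ L ∈ F.leaves, ∃ V : Set L.N, IsOpen V ∧ A = L.ι '' V}

/-- For `x ∈ U`, the tangent space at `x` of the leaf through `x` (the other leaves contribute
`⊥`). -/
noncomputable def tangentSpace (F : RegularFoliation m M U p) (x : M) :
    Submodule ℝ (TangentSpace (𝓡 m) x) :=
  ⨆ L ∈ F.leaves, L.tangentSpace x

end RegularFoliation

/-- `A` is saturated by members of `𝒞`, i.e. `A` is a union of members of `𝒞`. -/
def SaturatedBy (A : Set M) (𝒞 : Set (Set M)) : Prop :=
  ∃ 𝒮 ⊆ 𝒞, A = ⋃₀ 𝒮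

variable {I : Type*} {U : I → Set M} {r : I → ℕ}

/-- Each overlap is saturated by open subsets of leaves of the larger-dimensional foliation, and
each such open subset is saturated by open subsets of leaves of the smaller-dimensional one. -/
def IsFamilyOfFoliations (F : ∀ i, RegularFoliation m M (U i) (r i)) : Prop :=
  ∀ i j, (U i ∩ U j).Nonempty → r i < r j →
    SaturatedBy (U i ∩ U j) (F j).openSubsetsOfLeaves ∧
    ∀ A ∈ (F j).openSubsetsOfLeaves, A ⊆ U i ∩ U j → SaturatedBy A (F i).openSubsetsOfLeaves

/-- Each overlap is saturated by whole leaves of the larger-dimensional foliation, and each such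
leaf is saturated by whole leaves of the smaller-dimensional one. -/
def IsLocallyRegularFoliation (F : ∀ i, RegularFoliation m M (U i) (r i)) : Prop :=
  ∀ i j, (U i ∩ U j).Nonempty → r i < r j →
    SaturatedBy (U i ∩ U j) (F j).leafSets ∧
    ∀ A ∈ (F j).leafSets, A ⊆ U i ∩ U j → SaturatedBy A (F i).leafSets

/-- The rank of a point, `r(x) = max {r_i : x ∈ U_i}`. -/
noncomputable def pointRank (U : I → Set M) (r : I → ℕ) (x : M) : ℕ :=
  sSup {n | ∃ i, x ∈ U i ∧ r i = n}

/-- The distribution of the tangent spaces of the leaves of maximal dimension: `𝒟_x` is the tangent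
space at `x` of the leaf of `F i` through `x`, for the index `i` (unique when `r` is injective)
with `x ∈ U i` and `r i = r(x)`. -/
noncomputable def maximalDistribution (F : ∀ i, RegularFoliation m M (U i) (r i)) (x : M) :
    Submodule ℝ (TangentSpace (𝓡 m) x) :=
  ⨆ (i : I) (_ : x ∈ U i ∧ r i = pointRank U r x), (F i).tangentSpace x

/-- `X`, restricted to the open set `W`, is a smooth local vector field tangent to the singular
distribution `D`. -/
structure IsLocalSection [IsManifold (𝓡 m) ∞ M]
    (D : ∀ x : M, Submodule ℝ (TangentSpace (𝓡 m) x)) (W : Set M)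
    (X : ∀ x : M, TangentSpace (𝓡 m) x) : Prop where
  isOpen : IsOpen W
  smooth : ContMDiffOn (𝓡 m) (𝓡 m).tangent ∞ (fun x => (⟨x, X x⟩ : TangentBundle (𝓡 m) M)) W
  tangent : ∀ x ∈ W, X x ∈ D x

/-- Each `D x` is spanned by the values at `x` of smooth local vector fields tangent to `D`. -/
def IsSmoothDistribution [IsManifold (𝓡 m) ∞ M]
    (D : ∀ x : M, Submodule ℝ (TangentSpace (𝓡 m) x)) : Prop :=
  ∀ x, D x = Submodule.span ℝ {v | ∃ W X, IsLocalSection D W X ∧ x ∈ W ∧ X x = v}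

/-- `D` is smooth and `M` has a partition into connected immersed submanifolds (of possibly
different dimensions) whose tangent spaces are the subspaces `D x`. -/
def IsIntegrableDistribution [IsManifold (𝓡 m) ∞ M]
    (D : ∀ x : M, Submodule ℝ (TangentSpace (𝓡 m) x)) : Prop :=
  IsSmoothDistribution D ∧ ∃ 𝓛 : Set (ImmersedSubmanifold m M),
    IsPartitionIntoConnected 𝓛 Set.univ ∧ ∀ L ∈ 𝓛, ∀ x ∈ L.carrier, D x = L.tangentSpace x

end Manifolds

open Filter Topology Manifold

/-! Both parts rest on one inclusion: at a common point of `U i` and `U j` with `r i < r j`, the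
tangent space of `F i` lies in that of `F j`. The saturation conditions give it set-theoretically:
near the point a leaf of `F i` stays in one leaf of `F j`, and by `IsFlatChart.mfderiv_comp_mem` a
differentiable map into a leaf, whatever its continuity for the leaf topology, is tangent to the
foliation. Smoothness: a vector tangent to the foliation of maximal rank at `x` extends with
constant coordinates in a flat chart. The rank can only go up on that chart, and the inclusion keeps
the field tangent where it does. Integrability: under the whole-leaf condition a leaf meeting `U j`
of larger rank lies entirely in `U j`. Hence a leaf with maximal rank at one point has it at all
points, and such leaves partition `M`. -/

theorem mdifferentiable_of_mem_maximalAtlas {E H N : Type*} [NormedAddCommGroup E]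
    [NormedSpace ℝ E] [TopologicalSpace H] {J : ModelWithCorners ℝ E H} [TopologicalSpace N]
    [ChartedSpace H N] [IsManifold J ∞ N] {φ : OpenPartialHomeomorph N H}
    (hφ : φ ∈ IsManifold.maximalAtlas J ∞ N) : φ.MDifferentiable J J :=
  ⟨(contMDiffOn_of_mem_maximalAtlas hφ).mdifferentiableOn (by simp),
    (contMDiffOn_symm_of_mem_maximalAtlas hφ).mdifferentiableOn (by simp)⟩

variable {m : ℕ} {M : Type u} [TopologicalSpace M] [ChartedSpace (EuclideanSpace ℝ (Fin m)) M]

theorem ImmersedSubmanifold.mdifferentiable [IsManifold (𝓡 m) ∞ M]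
    (L : ImmersedSubmanifold m M) : MDifferentiable (𝓡 L.dim) (𝓡 m) L.ι :=
  L.isImmersion.contMDiff.mdifferentiable (by simp)

/-- In adapted charts the immersion is `w ↦ (w, 0)`; projecting to the first factor recovers the
domain chart, whose derivative is injective. -/
theorem ImmersedSubmanifold.mfderiv_injective [IsManifold (𝓡 m) ∞ M]
    (L : ImmersedSubmanifold m M) (y : L.N) :
    Function.Injective (mfderiv (𝓡 L.dim) (𝓡 m) L.ι y) := by
  have h := L.isImmersion.isImmersionAt y
  have hψ := mdifferentiable_of_mem_maximalAtlas h.codChart_mem_maximalAtlas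
  have hφ := mdifferentiable_of_mem_maximalAtlas h.domChart_mem_maximalAtlas
  let p : EuclideanSpace ℝ (Fin m) →L[ℝ] EuclideanSpace ℝ (Fin L.dim) :=
    (ContinuousLinearMap.fst ℝ _ _).comp h.equiv.symm.toContinuousLinearMap
  have heq : (p ∘ h.codChart) ∘ L.ι =ᶠ[𝓝 y] h.domChart := by
    filter_upwards [h.domChart.open_source.mem_nhds h.mem_domChart_source] with z hz
    have hz' : h.domChart z ∈ (h.domChart.extend (𝓡 L.dim)).target := by
      simpa using h.domChart.map_source hz
    have hw := h.writtenInCharts hz'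
    have hw' : h.codChart (L.ι z) = h.equiv (h.domChart z, 0) := by
      simpa [h.domChart.left_inv hz] using hw
    simp [p, hw']
  have hp : MDifferentiableAt (𝓡 m) (𝓡 L.dim) (p ∘ h.codChart) (L.ι y) :=
    p.contMDiff.mdifferentiable (by simp : (1 : ℕ∞ω) ≠ 0) |>.mdifferentiableAt.comp _
      (hψ.mdifferentiableAt h.mem_codChart_source)
  have hd := heq.mfderiv_eq (I := 𝓡 L.dim) (I' := 𝓡 L.dim)
  rw [mfderiv_comp y hp (L.mdifferentiable y)] at hd
  have hinj := hφ.mfderiv_injective h.mem_domChart_source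
  intro v w hvw
  apply hinj
  have hv := DFunLike.congr_fun hd v
  have hw := DFunLike.congr_fun hd w
  refine hv.symm.trans (Eq.trans ?_ hw)
  exact congrArg (mfderiv (𝓡 m) (𝓡 L.dim) (p ∘ h.codChart) (L.ι y)) hvw

/-! ### Tangent spaces of leaves in flat charts -/

/-- The vectors of `ℝ^m` whose coordinates of index at least `p` vanish. -/
def coordinateSubspace (m p : ℕ) : Submodule ℝ (EuclideanSpace ℝ (Fin m)) where
  carrier := {w | ∀ a : Fin m, p ≤ (a : ℕ) → w a = 0}
  add_mem' hv hw a ha := by simp [hv a ha, hw a ha]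
  zero_mem' a _ := by simp
  smul_mem' c w hw a ha := by simp [hw a ha]

theorem finrank_coordinateSubspace_le (m p : ℕ) :
    Module.finrank ℝ (coordinateSubspace m p) ≤ p := by
  let f : coordinateSubspace m p →ₗ[ℝ] (Fin p → ℝ) :=
    -- Padding with `0` allows `p > m`.
    { toFun := fun w b => if h : (b : ℕ) < m then w.1 ⟨b, h⟩ else 0
      map_add' := fun v w => by ext b; by_cases h : (b : ℕ) < m <;> simp [h]
      map_smul' := fun c w => by ext b; by_cases h : (b : ℕ) < m <;> simp [h] }
  have hf : Function.Injective f := by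
    rw [injective_iff_map_eq_zero]
    intro w hw
    ext a
    by_cases h : p ≤ (a : ℕ)
    · exact w.2 a h
    · simpa [f] using congrFun hw ⟨a, not_le.1 h⟩
  simpa using LinearMap.finrank_le_finrank_of_injective hf

/-- A map that locally takes values in one member of `𝓛` is tangent to the slices of every flat
chart of `𝓛`: its transverse coordinates are continuous with countably many values. -/
theorem IsFlatChart.mfderiv_comp_mem [IsManifold (𝓡 m) ∞ M] {𝓛 : Set (Set M)} {p n : ℕ}
    {φ : OpenPartialHomeomorph M (EuclideanSpace ℝ (Fin m))} (hφ : IsFlatChart 𝓛 p φ)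
    {N : Type*} [TopologicalSpace N] [ChartedSpace (EuclideanSpace ℝ (Fin n)) N]
    {f : N → M} (hf : MDifferentiable (𝓡 n) (𝓡 m) f) {z : N} (hz : f z ∈ φ.source)
    {A : Set M} (hA : A ∈ 𝓛) (hfA : ∀ᶠ w in 𝓝 z, f w ∈ A) (v : TangentSpace (𝓡 n) z) :
    mfderiv (𝓡 m) (𝓡 m) φ (f z) (mfderiv (𝓡 n) (𝓡 m) f z v) ∈ coordinateSubspace m p := by
  have hφd := mdifferentiable_of_mem_maximalAtlas hφ.mem_maximalAtlas
  obtain ⟨C, hC, hslice⟩ := hφ.slices A hA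
  have : LocallyConnectedSpace N :=
    ChartedSpace.locallyConnectedSpace (EuclideanSpace ℝ (Fin n)) N
  have hnear : {w | f w ∈ A ∧ f w ∈ φ.source} ∈ 𝓝 z :=
    hfA.and (hf.continuous.continuousAt (φ.open_source.mem_nhds hz))
  obtain ⟨V, ⟨hVo, hzV, hVc⟩, hVsub⟩ :=
    (locallyConnectedSpace_iff_hasBasis_isOpen_isConnected.1 this z).mem_iff.1 hnear
  let g : N → {a : Fin m // p ≤ (a : ℕ)} → ℝ := fun w a => φ (f w) a
  have hg : ContinuousOn g V := by
    refine continuousOn_pi.2 fun a => ?_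
    have h1 : ContinuousOn (fun w => φ (f w)) V :=
      φ.continuousOn.comp hf.continuous.continuousOn fun w hw => (hVsub hw).2
    exact (EuclideanSpace.proj (𝕜 := ℝ) (a : Fin m)).continuous.comp_continuousOn h1
  have hgC : g '' V ⊆ C := by
    rintro _ ⟨w, hw, rfl⟩
    exact (hslice _ (hVsub hw).2).1 (hVsub hw).1
  -- A countable set is totally disconnected, so the connected image is a single point.
  have hsub : (g '' V).Subsingleton :=
    hC.isTotallyDisconnected _ hgC (hVc.isPreconnected.image g hg)
  intro a ha
  let q : EuclideanSpace ℝ (Fin m) →L[ℝ] ℝ := EuclideanSpace.proj a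
  have hconst : (q ∘ φ) ∘ f =ᶠ[𝓝 z] fun _ => q (φ (f z)) := by
    filter_upwards [hVo.mem_nhds hzV] with w hw
    exact congrFun (hsub ⟨w, hw, rfl⟩ ⟨z, hzV, rfl⟩) ⟨a, ha⟩
  have h1 : HasMFDerivAt (𝓡 m) 𝓘(ℝ, ℝ) (q ∘ φ) (f z)
      (q.comp (mfderiv (𝓡 m) (𝓡 m) φ (f z))) :=
    q.hasMFDerivAt.comp (f z) (hφd.mdifferentiableAt hz).hasMFDerivAt
  have h2 := h1.comp z (hf z).hasMFDerivAt
  have h3 := hconst.mfderiv_eq (I := 𝓡 n) (I' := 𝓘(ℝ, ℝ))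
  rw [h2.mfderiv, mfderiv_const] at h3
  exact DFunLike.congr_fun h3 v

namespace RegularFoliation

variable {U : Set M} {p : ℕ}

theorem exists_leaf (F : RegularFoliation m M U p) {x : M} (hx : x ∈ U) :
    ∃ L ∈ F.leaves, ∃ z : L.N, L.ι z = x := by
  rw [← F.isPartition.iUnion_eq] at hx
  simpa [ImmersedSubmanifold.carrier] using hx

theorem carrier_subset (F : RegularFoliation m M U p) {L : ImmersedSubmanifold m M}
    (hL : L ∈ F.leaves) : L.carrier ⊆ U := by
  rw [← F.isPartition.iUnion_eq]
  exact Set.subset_biUnion_of_mem (u := ImmersedSubmanifold.carrier) hL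

theorem eq_of_mem (F : RegularFoliation m M U p) {L L' : ImmersedSubmanifold m M}
    (hL : L ∈ F.leaves) (hL' : L' ∈ F.leaves) {x : M} (hx : x ∈ L.carrier)
    (hx' : x ∈ L'.carrier) : L = L' :=
  F.isPartition.pairwiseDisjoint.elim_set hL hL' x hx hx'

theorem tangentSpace_eq (F : RegularFoliation m M U p) {L : ImmersedSubmanifold m M}
    (hL : L ∈ F.leaves) {x : M} (hx : x ∈ L.carrier) :
    F.tangentSpace x = L.tangentSpace x := by
  refine le_antisymm (iSup₂_le fun L' hL' => ?_) (le_iSup₂_of_le L hL le_rfl)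
  refine iSup₂_le fun y hy => ?_
  obtain rfl := F.eq_of_mem hL hL' hx ⟨y, hy⟩
  exact le_iSup₂_of_le y hy le_rfl

/-- Slices give one inclusion; equality follows by dimension, since the leaf contributes exactly `p`
and the coordinate subspace has at most `p`. -/
theorem mem_tangentSpace_iff [IsManifold (𝓡 m) ∞ M] (F : RegularFoliation m M U p)
    {φ : OpenPartialHomeomorph M (EuclideanSpace ℝ (Fin m))}
    (hφ : IsFlatChart (ImmersedSubmanifold.carrier '' F.leaves) p φ) {x : M} (hxU : x ∈ U)
    (hx : x ∈ φ.source) (v : TangentSpace (𝓡 m) x) :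
    v ∈ F.tangentSpace x ↔ mfderiv (𝓡 m) (𝓡 m) φ x v ∈ coordinateSubspace m p := by
  obtain ⟨L, hL, z, rfl⟩ := F.exists_leaf hxU
  rw [F.tangentSpace_eq hL ⟨z, rfl⟩, L.tangentSpace_apply]
  have hφd := mdifferentiable_of_mem_maximalAtlas hφ.mem_maximalAtlas
  let A : EuclideanSpace ℝ (Fin L.dim) →ₗ[ℝ] EuclideanSpace ℝ (Fin m) :=
    (mfderiv (𝓡 m) (𝓡 m) φ (L.ι z)).toLinearMap ∘ₗ
      (mfderiv (𝓡 L.dim) (𝓡 m) L.ι z).toLinearMap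
  have hA : Function.Injective A :=
    (hφd.mfderiv_injective hx).comp (L.mfderiv_injective z)
  have hle : LinearMap.range A ≤ coordinateSubspace m p := by
    rintro _ ⟨w, rfl⟩
    exact hφ.mfderiv_comp_mem L.mdifferentiable hx (Set.mem_image_of_mem _ hL)
      (Eventually.of_forall fun w => ⟨w, rfl⟩) w
  have heq : LinearMap.range A = coordinateSubspace m p := by
    refine Submodule.eq_of_le_of_finrank_le hle ?_
    rw [LinearMap.finrank_range_of_inj hA, finrank_euclideanSpace_fin, F.dim_eq L hL]
    exact finrank_coordinateSubspace_le m p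
  rw [← heq]
  constructor
  · rintro ⟨w, rfl⟩
    exact ⟨w, rfl⟩
  · rintro ⟨w, hw⟩
    exact ⟨w, hφd.mfderiv_injective hx hw⟩

/-- A map that locally takes values in one leaf is tangent to the foliation. -/
theorem mfderiv_mem_tangentSpace [IsManifold (𝓡 m) ∞ M] (F : RegularFoliation m M U p) {n : ℕ}
    {N : Type*} [TopologicalSpace N] [ChartedSpace (EuclideanSpace ℝ (Fin n)) N]
    {f : N → M} (hf : MDifferentiable (𝓡 n) (𝓡 m) f) {z : N}
    {L : ImmersedSubmanifold m M} (hL : L ∈ F.leaves) (hfL : ∀ᶠ w in 𝓝 z, f w ∈ L.carrier)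
    (v : TangentSpace (𝓡 n) z) :
    mfderiv (𝓡 n) (𝓡 m) f z v ∈ F.tangentSpace (f z) := by
  have hU : f z ∈ U := F.carrier_subset hL hfL.self_of_nhds
  obtain ⟨φ, hx, -, hφ⟩ := F.exists_flatChart _ hU
  rw [F.mem_tangentSpace_iff hφ hU hx]
  exact hφ.mfderiv_comp_mem hf hx (Set.mem_image_of_mem _ hL) hfL v

theorem dim_le [IsManifold (𝓡 m) ∞ M] (F : RegularFoliation m M U p) (hU : U.Nonempty) :
    p ≤ m := by
  obtain ⟨x, hx⟩ := hU
  obtain ⟨L, hL, z, -⟩ := F.exists_leaf hx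
  let A : EuclideanSpace ℝ (Fin L.dim) →ₗ[ℝ] EuclideanSpace ℝ (Fin m) :=
    (mfderiv (𝓡 L.dim) (𝓡 m) L.ι z).toLinearMap
  have hA : Function.Injective A := L.mfderiv_injective z
  simpa [F.dim_eq L hL] using LinearMap.finrank_le_finrank_of_injective hA

/-- If near `x` the leaf of `F` is contained in the leaf of `F'`, then so is its tangent space. -/
theorem tangentSpace_le [IsManifold (𝓡 m) ∞ M] {U' : Set M} {p' : ℕ}
    (F : RegularFoliation m M U p) (F' : RegularFoliation m M U' p')
    {L L' : ImmersedSubmanifold m M} (hL : L ∈ F.leaves) (hL' : L' ∈ F'.leaves) (z : L.N)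
    (h : ∀ᶠ w in 𝓝 z, L.ι w ∈ L'.carrier) :
    F.tangentSpace (L.ι z) ≤ F'.tangentSpace (L.ι z) := by
  rw [F.tangentSpace_eq hL ⟨z, rfl⟩, L.tangentSpace_apply]
  rintro _ ⟨v, rfl⟩
  exact F'.mfderiv_mem_tangentSpace L.mdifferentiable hL' h v

end RegularFoliation

/-! ### The rank of a point -/

section PointRank

variable {I : Type*} {U : I → Set M} {r : I → ℕ}

/-- Needed because `sSup` of an unbounded set of naturals is the default value `0`. -/
theorem bddAbove_ranks [IsManifold (𝓡 m) ∞ M] (F : ∀ i, RegularFoliation m M (U i) (r i))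
    (x : M) : BddAbove {n | ∃ i, x ∈ U i ∧ r i = n} := by
  refine ⟨m, ?_⟩
  rintro _ ⟨i, hi, rfl⟩
  exact (F i).dim_le ⟨x, hi⟩

theorem le_pointRank [IsManifold (𝓡 m) ∞ M] (F : ∀ i, RegularFoliation m M (U i) (r i)) {x : M}
    {i : I} (hi : x ∈ U i) : r i ≤ pointRank U r x :=
  le_csSup (s := {n | ∃ i, x ∈ U i ∧ r i = n}) (bddAbove_ranks F x) ⟨i, hi, rfl⟩

theorem exists_eq_pointRank [IsManifold (𝓡 m) ∞ M]
    (F : ∀ i, RegularFoliation m M (U i) (r i)) (hU_cover : ⋃ i, U i = Set.univ) (x : M) :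
    ∃ i, x ∈ U i ∧ r i = pointRank U r x := by
  obtain ⟨i, hi⟩ := Set.mem_iUnion.1 (hU_cover ▸ Set.mem_univ x)
  exact Nat.sSup_mem (s := {n | ∃ i, x ∈ U i ∧ r i = n}) ⟨r i, i, hi, rfl⟩ (bddAbove_ranks F x)

theorem maximalDistribution_eq (F : ∀ i, RegularFoliation m M (U i) (r i))
    (hr : Function.Injective r) {x : M} {i : I} (hi : x ∈ U i) (hri : r i = pointRank U r x) :
    maximalDistribution F x = (F i).tangentSpace x := by
  refine le_antisymm (iSup₂_le fun j hj => ?_) (le_iSup₂_of_le i ⟨hi, hri⟩ le_rfl)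
  obtain rfl := hr (hj.2.trans hri.symm)
  exact le_rfl

end PointRank

/-! ### Vector fields constant in a chart -/

/-- The vector field on the source of the chart `φ` with constant coordinates `w`. -/
noncomputable def chartVectorField (φ : OpenPartialHomeomorph M (EuclideanSpace ℝ (Fin m)))
    (w : EuclideanSpace ℝ (Fin m)) (x : M) : TangentSpace (𝓡 m) x :=
  VectorField.mpullback (𝓡 m) (𝓡 m) φ
    (fun z => (show TangentSpace (𝓡 m) z from w)) x

theorem contMDiffOn_chartVectorField [IsManifold (𝓡 m) ∞ M]
    {φ : OpenPartialHomeomorph M (EuclideanSpace ℝ (Fin m))}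
    (hφ : φ ∈ IsManifold.maximalAtlas (𝓡 m) ∞ M) (w : EuclideanSpace ℝ (Fin m)) :
    ContMDiffOn (𝓡 m) (𝓡 m).tangent ∞
      (fun x => (⟨x, chartVectorField φ w x⟩ : TangentBundle (𝓡 m) M)) φ.source := by
  have hφd := mdifferentiable_of_mem_maximalAtlas hφ
  intro x hx
  have hw : ContMDiffAt (𝓡 m) (𝓡 m).tangent ∞
      (fun z => (⟨z, w⟩ : TangentBundle (𝓡 m) (EuclideanSpace ℝ (Fin m)))) (φ x) :=
    contMDiffAt_vectorSpace_iff_contDiffAt.2 contDiffAt_const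
  have hinv : (mfderiv (𝓡 m) (𝓡 m) φ x).IsInvertible := ⟨hφd.mfderiv hx, rfl⟩
  exact (hw.mpullback_vectorField_preimage (contMDiffAt_of_mem_maximalAtlas hφ hx)
    hinv (by simp)).contMDiffWithinAt

theorem mfderiv_chartVectorField [IsManifold (𝓡 m) ∞ M]
    {φ : OpenPartialHomeomorph M (EuclideanSpace ℝ (Fin m))}
    (hφ : φ ∈ IsManifold.maximalAtlas (𝓡 m) ∞ M) (w : EuclideanSpace ℝ (Fin m)) {x : M}
    (hx : x ∈ φ.source) :
    mfderiv (𝓡 m) (𝓡 m) φ x (chartVectorField φ w x) = w := by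
  have hφd := mdifferentiable_of_mem_maximalAtlas hφ
  have hinv : (mfderiv (𝓡 m) (𝓡 m) φ x).IsInvertible := ⟨hφd.mfderiv hx, rfl⟩
  exact hinv.self_apply_inverse w

/-! ### Smoothness and integrability -/

section Main

variable {I : Type*} {U : I → Set M} {r : I → ℕ}

theorem isSmoothDistribution_of_tangentSpace_le [IsManifold (𝓡 m) ∞ M]
    (hU_cover : ⋃ i, U i = Set.univ) (F : ∀ i, RegularFoliation m M (U i) (r i))
    (hr : Function.Injective r)
    (hF : ∀ i j x, x ∈ U i → x ∈ U j → r i < r j →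
      (F i).tangentSpace x ≤ (F j).tangentSpace x) :
    IsSmoothDistribution (maximalDistribution F) := by
  intro x
  refine le_antisymm (fun v hv => Submodule.subset_span ?_) (Submodule.span_le.2 ?_)
  · obtain ⟨i, hi, hri⟩ := exists_eq_pointRank F hU_cover x
    obtain ⟨φ, hx, hφU, hφ⟩ := (F i).exists_flatChart x hi
    rw [maximalDistribution_eq F hr hi hri, (F i).mem_tangentSpace_iff hφ hi hx] at hv
    refine ⟨φ.source, chartVectorField φ (mfderiv (𝓡 m) (𝓡 m) φ x v), ⟨φ.open_source,
      contMDiffOn_chartVectorField hφ.mem_maximalAtlas _, fun y hy => ?_⟩, hx, ?_⟩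
    · have hmem : chartVectorField φ (mfderiv (𝓡 m) (𝓡 m) φ x v) y ∈ (F i).tangentSpace y :=
        ((F i).mem_tangentSpace_iff hφ (hφU hy) hy _).2
          ((congrArg (· ∈ coordinateSubspace m (r i))
            (mfderiv_chartVectorField hφ.mem_maximalAtlas _ hy)).mpr hv)
      obtain ⟨j, hj, hrj⟩ := exists_eq_pointRank F hU_cover y
      rw [maximalDistribution_eq F hr hj hrj]
      -- The chart lies in `U i`, so the rank at `y` is at least `r i`; `hF` handles a jump.
      rcases (hrj ▸ le_pointRank F (hφU hy) : r i ≤ r j).lt_or_eq with hlt | heq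
      · exact hF i j y (hφU hy) hj hlt hmem
      · obtain rfl := hr heq
        exact hmem
    · exact (mdifferentiable_of_mem_maximalAtlas hφ.mem_maximalAtlas).mfderiv_injective hx
        (mfderiv_chartVectorField hφ.mem_maximalAtlas _ hx)
  · rintro _ ⟨W, X, hX, hxW, rfl⟩
    exact hX.tangent x hxW

theorem IsFamilyOfFoliations.tangentSpace_le [IsManifold (𝓡 m) ∞ M]
    {F : ∀ i, RegularFoliation m M (U i) (r i)} (h : IsFamilyOfFoliations F) {i j : I} {x : M}
    (hi : x ∈ U i) (hj : x ∈ U j) (hij : r i < r j) :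
    (F i).tangentSpace x ≤ (F j).tangentSpace x := by
  obtain ⟨⟨𝒮, h𝒮, hUS⟩, h2⟩ := h i j ⟨x, hi, hj⟩ hij
  obtain ⟨A, hA, hxA⟩ : x ∈ ⋃₀ 𝒮 := hUS ▸ Set.mem_inter hi hj
  obtain ⟨𝒯, h𝒯, rfl⟩ := h2 A (h𝒮 hA) (hUS ▸ Set.subset_sUnion_of_mem hA)
  obtain ⟨B, hB, hxB⟩ := hxA
  obtain ⟨L', hL', V', -, hA'⟩ := h𝒮 hA
  obtain ⟨L, hL, V, hV, rfl⟩ := h𝒯 hB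
  obtain ⟨z, hz, rfl⟩ := hxB
  refine (F i).tangentSpace_le (F j) hL hL' z ?_
  -- Openness of `V` in the manifold topology of `L` turns `B ⊆ A` into a statement near `z`.
  filter_upwards [hV.mem_nhds hz] with w hw
  have hw' : L.ι w ∈ L'.ι '' V' := hA' ▸ ⟨_, hB, w, hw, rfl⟩
  exact Set.image_subset_range _ _ hw'

/-- The leaf of `F i` through a point of `U i ∩ U j` lies in the leaf of `F j`, for `r i < r j`. -/
theorem IsLocallyRegularFoliation.exists_carrier_subset
    {F : ∀ i, RegularFoliation m M (U i) (r i)} (h : IsLocallyRegularFoliation F) {i j : I}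
    (hij : r i < r j) {L : ImmersedSubmanifold m M} (hL : L ∈ (F i).leaves) {x : M}
    (hx : x ∈ L.carrier) (hj : x ∈ U j) : ∃ L' ∈ (F j).leaves, L.carrier ⊆ L'.carrier := by
  have hi := (F i).carrier_subset hL hx
  obtain ⟨⟨𝒮, h𝒮, hUS⟩, h2⟩ := h i j ⟨x, hi, hj⟩ hij
  obtain ⟨A, hA, hxA⟩ : x ∈ ⋃₀ 𝒮 := hUS ▸ Set.mem_inter hi hj
  obtain ⟨𝒯, h𝒯, hAT⟩ := h2 A (h𝒮 hA) (hUS ▸ Set.subset_sUnion_of_mem hA)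
  obtain ⟨L', hL', rfl⟩ := h𝒮 hA
  obtain ⟨B, hB, hxB⟩ := hAT ▸ hxA
  obtain ⟨L₁, hL₁, rfl⟩ := h𝒯 hB
  -- The saturating leaf through `x` can only be `L`, so all of `L` lies in `A`.
  obtain rfl := (F i).eq_of_mem hL hL₁ hx hxB
  exact ⟨L', hL', hAT ▸ Set.subset_sUnion_of_mem hB⟩

theorem IsLocallyRegularFoliation.tangentSpace_le [IsManifold (𝓡 m) ∞ M]
    {F : ∀ i, RegularFoliation m M (U i) (r i)} (h : IsLocallyRegularFoliation F) {i j : I}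
    {x : M} (hi : x ∈ U i) (hj : x ∈ U j) (hij : r i < r j) :
    (F i).tangentSpace x ≤ (F j).tangentSpace x := by
  obtain ⟨L, hL, z, rfl⟩ := (F i).exists_leaf hi
  obtain ⟨L', hL', hsub⟩ := h.exists_carrier_subset hij hL ⟨z, rfl⟩ hj
  exact (F i).tangentSpace_le (F j) hL hL' z (Eventually.of_forall fun w => hsub ⟨w, rfl⟩)

/-- The leaves of the `F i` all of whose points have rank `r i`. -/
def maximalLeaves (F : ∀ i, RegularFoliation m M (U i) (r i)) : Set (ImmersedSubmanifold m M) :=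
  {L | ∃ i, L ∈ (F i).leaves ∧ ∀ x ∈ L.carrier, r i = pointRank U r x}

theorem IsLocallyRegularFoliation.isPartition_maximalLeaves [IsManifold (𝓡 m) ∞ M]
    (hU_cover : ⋃ i, U i = Set.univ) {F : ∀ i, RegularFoliation m M (U i) (r i)}
    (hr : Function.Injective r) (h : IsLocallyRegularFoliation F) :
    IsPartitionIntoConnected (maximalLeaves F) Set.univ where
  connected := fun L ⟨i, hL, _⟩ => (F i).isPartition.connected L hL
  pairwiseDisjoint := by
    rintro L ⟨i, hL, hLr⟩ L' ⟨j, hL', hLr'⟩ hne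
    refine Set.disjoint_left.2 fun x hx hx' => hne ?_
    -- Both indices equal the rank at the common point, so the two leaves belong to the same
    -- foliation.
    obtain rfl := hr ((hLr x hx).trans (hLr' x hx').symm)
    exact (F i).eq_of_mem hL hL' hx hx'
  iUnion_eq := by
    refine Set.eq_univ_of_forall fun x => ?_
    obtain ⟨i, hi, hri⟩ := exists_eq_pointRank F hU_cover x
    obtain ⟨L, hL, z, rfl⟩ := (F i).exists_leaf hi
    refine Set.mem_biUnion (x := L) ⟨i, hL, fun y hy => ?_⟩ ⟨z, rfl⟩
    obtain ⟨j, hj, hrj⟩ := exists_eq_pointRank F hU_cover y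
    -- A larger rank at `y`, attained by `j`, would put all of `L` in `U j`, including the starting
    -- point, whose rank is only `r i`.
    refine (le_pointRank F ((F i).carrier_subset hL hy)).antisymm (not_lt.1 fun hlt => ?_)
    rw [← hrj] at hlt
    obtain ⟨L', hL', hsub⟩ := h.exists_carrier_subset hlt hL hy hj
    exact (hri ▸ hlt).not_ge (le_pointRank F ((F j).carrier_subset hL' (hsub ⟨z, rfl⟩)))

end Main

theorem proposition2p1 {m : ℕ} {M : Type u} [TopologicalSpace M] [T2Space M]
    [SecondCountableTopology M] [ChartedSpace (EuclideanSpace ℝ (Fin m)) M]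
    [IsManifold (𝓡 m) ∞ M]
    {I : Type*} (U : I → Set M) (hU_open : ∀ i, IsOpen (U i)) (hU_cover : ⋃ i, U i = Set.univ)
    (r : I → ℕ) (F : ∀ i, RegularFoliation m M (U i) (r i)) (hr : Function.Injective r) :
    (IsFamilyOfFoliations F → IsSmoothDistribution (maximalDistribution F)) ∧
    (IsLocallyRegularFoliation F → IsIntegrableDistribution (maximalDistribution F)) := by
  refine ⟨fun h => isSmoothDistribution_of_tangentSpace_le hU_cover F hr
    fun i j x hi hj hij => h.tangentSpace_le hi hj hij, fun h =>
    ⟨isSmoothDistribution_of_tangentSpace_le hU_cover F hr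
      fun i j x hi hj hij => h.tangentSpace_le hi hj hij,
      maximalLeaves F, h.isPartition_maximalLeaves hU_cover hr, ?_⟩⟩
  rintro L ⟨i, hL, hLr⟩ x hx
  rw [maximalDistribution_eq F hr ((F i).carrier_subset hL hx) (hLr x hx),
    (F i).tangentSpace_eq hL hx]
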